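/- **Model.** A TCP connection uses $M\ge 1$ paths; in every time slot (one round-trip time) the wireless router of each path transmits $C$ packets. In each slot every path $l$ draws a packet success probability $p_l$, independently over paths and slots, with the law of a random variable $P$ that takes finitely many values $0<p_1<p_2<\dots<p_\Pi\le 1$ with given probabilities; given these, each transmitted packet of path $l$ is received with probability $p_l$, independently of all others. With congestion window $w$ (a positive integer) the channel fails with probability $$f_{\mathrm{chan}}(w)=\mathbb P(\text{fewer than } w \text{ of the } MC \text{ packets are received}).$$ An AQM is a function $f:\mathbb N\to[0,1]$; it marks a window $w$ with probability $f(w)$, independently of the channel. Put $f_{\mathrm{eff}}(w)=1-(1-f(w))(1-f_{\mathrm{chan}}(w))$. The window is the Markov chain on $\{1,2,\dots\}$ that moves from $w$ to $\lceil w/2\rceil$ with probability $f_{\mathrm{eff}}(w)$ and to $w+1$ with probability $1-f_{\mathrm{eff}}(w)$. Let $\mathbb E[W^*]$ be the largest mean of the window in a stationary distribution of the chain, over all AQMs. Let $$l'(a)=\sup_{\theta\in\mathbb R}\bigl\{\theta a-\log\mathbb E[e^{\theta(1-P)}]\bigr\}\in[0,+\infty],\qquad e^{-\infty}=0 .$$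 **Theorem.** Fix the law of $P$ and $\rho>1$. There are sequences $\delta_1=\delta_1(C)\to0$ and $\delta_2=\delta_2(C)\to 0$ as $C\to\infty$, a number $C_0$ and constants $c_1,c_2>0$, all depending only on $\rho$ and the law of $P$, such that for all $M\ge1$ and all $C\ge C_0$ an optimal AQM exists (the maximum $\mathbb E[W^*]$ is attained) and the following hold. 1. $\mathbb E[W^*]\ge 0.75\,p_1MC/\rho^2-1$. 2. If $\beta\in[p_1MC/\rho^2,\ \mathbb E[P]MC/\rho^2]$ solves $1/\beta=\exp\bigl(-Ml'(1-\rho\beta/(MC))\bigr)$, then $$\mathbb E[W^*]\ \ge\ \max\Bigl\{\tfrac{0.75\,p_1MC}{\rho^2}-1,\ \min\Bigl\{\tfrac{\mathbb E[P]MC}{\rho^2}\bigl[1-3\delta_1-2(e^{-1}+\delta_2)\bigr],\ \beta\bigl[1-3\lfloor\beta\rfloor^{-1}-2(e^{-1}+\delta_2)\bigr]\Bigr\}\Bigr\}.$$ 3. If instead $1/B>\exp\bigl(-Ml'(1-\rho B/(MC))\bigr)$ at $B=\mathbb E[P]MC/\rho^2$ (there are enough paths for full diversity), then $$\mathbb E[W^*]\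 \ge\ \max\Bigl\{\tfrac{0.75\,p_1MC}{\rho^2}-1,\ \tfrac{\mathbb E[P]MC}{\rho^2}\bigl[1-3\delta_1-2(e^{-1}+\delta_2)\bigr]\Bigr\}.$$ 4. $c_1\,\mathbb E[P]MC\le\mathbb E[W^*]\le c_2\,\mathbb E[P]MC$, that is, the throughput is of order $\Theta(\mathbb E[P]MC)$. -/

import Mathlib

open Filter Topology

noncomputable section

namespace TCPRLC

/-- The law of the per-slot packet success probability `P` of one path: finitely many levels
`0 < p 0 < p 1 < ⋯ < p K ≤ 1`, the level `p k` having probability `q k`. -/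
structure ChannelLaw where
  K : ℕ
  p : Fin (K + 1) → ℝ
  q : Fin (K + 1) → ℝ
  p_strictMono : StrictMono p
  p_min_pos : 0 < p 0
  p_max_le_one : p (Fin.last K) ≤ 1
  q_nonneg : ∀ k, 0 ≤ q k
  q_sum : ∑ k, q k = 1

namespace ChannelLaw

variable (law : ChannelLaw)

/-- The smallest level, `p₁` in the usual numbering. -/
def pMin : ℝ := law.p 0

/-- `E[P]`. -/
def meanP : ℝ := ∑ k, law.q k * law.p k

/-- The moment generating function `E[exp(θ (1 - P))]`. -/
def lossMgf (θ : ℝ) : ℝ := ∑ k, law.q k * Real.exp (θ * (1 - law.p k))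

/-- The rate function `l'(a) = sup_θ (θ a - log E[exp(θ (1 - P))])`. It is `+∞` for `a` above
the largest possible value of `1 - P`, hence the extended real values. -/
def rate (a : ℝ) : EReal := ⨆ θ : ℝ, ((θ * a - Real.log (law.lossMgf θ) : ℝ) : EReal)

/-- `exp (-M l'(a))`, with the usual `exp (-∞) = 0`. -/
def expNegRate (M : ℕ) (a : ℝ) : ℝ :=
  (EReal.exp (-(((M : ℝ) : EReal) * law.rate a))).toReal

/-- The probability that, in one time slot, path `l` is at level `k l` for every `l` (the levels
are i.i.d. over the paths) and packet `j` of path `l` is received (`H l j = true`) or dropped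
(`H l j = false`) as prescribed by `H` (given the levels, packets are dropped independently). -/
def slotProb {M C : ℕ} (k : Fin M → Fin (law.K + 1)) (H : Fin M → Fin C → Bool) : ℝ :=
  (∏ l, law.q (k l)) * ∏ l, ∏ j, (if H l j then law.p (k l) else 1 - law.p (k l))

end ChannelLaw

/-- The number of packets received over all paths in one time slot. -/
def received {M C : ℕ} (H : Fin M → Fin C → Bool) : ℕ := ∑ l, ∑ j, if H l j then 1 else 0

namespace ChannelLaw

variable (law : ChannelLaw)

/-- The probability that the destination cannot reconstruct `w` data packets from what it gets in
one slot, each of the `M` paths transmitting `C` packets: fewer than `w` packets are received. -/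
def fChan (M C w : ℕ) : ℝ :=
  ∑ k : Fin M → Fin (law.K + 1), ∑ H : Fin M → Fin C → Bool,
    if received H < w then law.slotProb k H else 0

/-- The probability that the window `w` is halved, if the AQM marks it with probability `f w`. -/
def fEff (M C : ℕ) (f : ℕ → ℝ) (w : ℕ) : ℝ := 1 - (1 - f w) * (1 - law.fChan M C w)

/-- The transition probabilities of the congestion window: `w` moves to `⌈w / 2⌉` with
probability `fEff w` and to `w + 1` otherwise. -/
def trans (M C : ℕ) (f : ℕ → ℝ) (w w' : ℕ) : ℝ :=
  (if w' = w + 1 then 1 - law.fEff M C f w else 0) +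
    (if w' = (w + 1) / 2 then law.fEff M C f w else 0)

/-- `π` is a stationary distribution, on the windows `w ≥ 1`, of the congestion window under the
AQM `f`. -/
structure IsStationary (M C : ℕ) (f π : ℕ → ℝ) : Prop where
  nonneg : ∀ w, 0 ≤ π w
  zero : π 0 = 0
  hasSum_one : HasSum π 1
  invariant : ∀ w', HasSum (fun w => π w * law.trans M C f w w') (π w')

end ChannelLaw

/-- An AQM is a marking function: a window `w` is marked with probability `f w`. -/
def IsAQM (f : ℕ → ℝ) : Prop := ∀ w, 0 ≤ f w ∧ f w ≤ 1

namespace ChannelLaw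

variable (law : ChannelLaw)

/-- The stationary mean windows `E[W]` that can be achieved by some AQM. -/
def meanWindows (M C : ℕ) : Set ℝ :=
  {m | ∃ f π : ℕ → ℝ, IsAQM f ∧ law.IsStationary M C f π ∧ HasSum (fun w : ℕ => (w : ℝ) * π w) m}

/-- `E[W*]`, the mean congestion window under the optimal AQM. -/
def optimalMeanWindow (M C : ℕ) : ℝ := sSup (law.meanWindows M C)

end ChannelLaw

end TCPRLC

end

namespace TCPRLC

namespace ChannelLaw

variable (law : ChannelLaw)

/-! Upper bound and attainment: windows above `M * C` always fail, so every stationary law lives on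
`1..M * C + 1`. The mean is then at most `M * C + 1`, and the achievable means are a continuous
image of a compact set of pairs (AQM, stationary law).

Lower bounds: mark exactly the windows `w ≥ N`. Testing stationarity against `w` and `w²` gives
`E[e(W)(W + 1 - ⌈W/2⌉)] = 1` and `E[e(W)((W + 1)² - ⌈W/2⌉²)] = 2m + 1`, with `e` the halving
probability and `m` the mean. If the channel fails with probability at most `ε` below `N`, the first
identity forces the state `N` to contribute at least `1 - ε(1 + m/2)`; the second weights that
contribution by at least `1.5N + 1` (`exists_mem_meanWindows`).

The estimate of `ε` has two sources (`fChan_le`). Poor path levels are impossible near `p₁MC` and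
are bounded by `exp(-M l')` below `E[P]MC`; packet losses at given levels are exponentially rare by
Chernoff. With `ε` negligible, `m` is about `0.75N`; with `ε = 2/β`, `m ≥ 0.27β`. Since `1 - 2/e <
0.27`, both error sequences can be zero. -/

lemma pMin_pos : 0 < law.pMin := law.p_min_pos

lemma pMin_le (k : Fin (law.K + 1)) : law.pMin ≤ law.p k :=
  law.p_strictMono.monotone (Fin.zero_le k)

lemma p_pos (k : Fin (law.K + 1)) : 0 < law.p k := law.pMin_pos.trans_le (law.pMin_le k)

lemma p_le_one (k : Fin (law.K + 1)) : law.p k ≤ 1 :=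
  (law.p_strictMono.monotone (Fin.le_last k)).trans law.p_max_le_one

lemma pMin_le_meanP : law.pMin ≤ law.meanP := by
  calc law.pMin = ∑ k, law.q k * law.pMin := by rw [← Finset.sum_mul, law.q_sum, one_mul]
    _ ≤ law.meanP :=
      Finset.sum_le_sum fun k _ => mul_le_mul_of_nonneg_left (law.pMin_le k) (law.q_nonneg k)

lemma meanP_le_one : law.meanP ≤ 1 := by
  calc law.meanP ≤ ∑ k, law.q k * 1 :=
      Finset.sum_le_sum fun k _ => mul_le_mul_of_nonneg_left (law.p_le_one k) (law.q_nonneg k)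
    _ = 1 := by simp [law.q_sum]

lemma meanP_pos : 0 < law.meanP := law.pMin_pos.trans_le law.pMin_le_meanP

/-! ### Channel failure as a mixture over path levels -/

/-- The probability that the packets of one slot are received as prescribed by `H`, given the
levels `k` of the paths. -/
noncomputable def packetProb {M C : ℕ} (k : Fin M → Fin (law.K + 1)) (H : Fin M → Fin C → Bool) :
    ℝ :=
  ∏ l, ∏ j, (if H l j then law.p (k l) else 1 - law.p (k l))

lemma packetProb_nonneg {M C : ℕ} (k : Fin M → Fin (law.K + 1)) (H : Fin M → Fin C → Bool) :
    0 ≤ law.packetProb k H := by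
  refine Finset.prod_nonneg fun l _ => Finset.prod_nonneg fun j _ => ?_
  split_ifs
  · exact (law.p_pos _).le
  · exact sub_nonneg.2 (law.p_le_one _)

lemma sum_prod_prod {M C : ℕ} (g : Fin M → Bool → ℝ) :
    ∑ H : Fin M → Fin C → Bool, ∏ l, ∏ j, g l (H l j) = ∏ l, (∑ b, g l b) ^ C := by
  rw [← Fintype.prod_sum (fun l (h : Fin C → Bool) => ∏ j, g l (h j))]
  refine Finset.prod_congr rfl fun l _ => ?_
  rw [← Fintype.prod_sum (fun (_ : Fin C) b => g l b)]
  simp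

lemma sum_packetProb {M C : ℕ} (k : Fin M → Fin (law.K + 1)) :
    ∑ H : Fin M → Fin C → Bool, law.packetProb k H = 1 := by
  have := sum_prod_prod (C := C) fun (l : Fin M) b =>
    if b then law.p (k l) else 1 - law.p (k l)
  unfold packetProb
  rw [this]
  simp

lemma pathWeight_nonneg {M : ℕ} (k : Fin M → Fin (law.K + 1)) : 0 ≤ ∏ l, law.q (k l) :=
  Finset.prod_nonneg fun _ _ => law.q_nonneg _

lemma sum_pathWeight (M : ℕ) : ∑ k : Fin M → Fin (law.K + 1), ∏ l, law.q (k l) = 1 := by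
  rw [← Fintype.prod_sum (fun (_ : Fin M) b => law.q b)]
  simp [law.q_sum]

/-- The probability that fewer than `w` packets are received, given the levels `k`. -/
noncomputable def condFail {M : ℕ} (C w : ℕ) (k : Fin M → Fin (law.K + 1)) : ℝ :=
  ∑ H : Fin M → Fin C → Bool, if received H < w then law.packetProb k H else 0

lemma fChan_eq (M C w : ℕ) :
    law.fChan M C w = ∑ k : Fin M → Fin (law.K + 1), (∏ l, law.q (k l)) * law.condFail C w k := by
  simp only [fChan, condFail, slotProb, packetProb, Finset.mul_sum, mul_ite, mul_zero]

lemma condFail_nonneg {M : ℕ} (C w : ℕ) (k : Fin M → Fin (law.K + 1)) :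
    0 ≤ law.condFail C w k := by
  refine Finset.sum_nonneg fun H _ => ?_
  split_ifs
  · exact law.packetProb_nonneg k H
  · exact le_rfl

lemma condFail_le_one {M : ℕ} (C w : ℕ) (k : Fin M → Fin (law.K + 1)) :
    law.condFail C w k ≤ 1 := by
  rw [← law.sum_packetProb (C := C) k]
  refine Finset.sum_le_sum fun H _ => ?_
  split_ifs
  · exact le_rfl
  · exact law.packetProb_nonneg k H

lemma fChan_nonneg (M C w : ℕ) : 0 ≤ law.fChan M C w := by
  rw [fChan_eq]
  exact Finset.sum_nonneg fun k _ => mul_nonneg (law.pathWeight_nonneg k) (law.condFail_nonneg C w k)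

lemma fChan_le_one (M C w : ℕ) : law.fChan M C w ≤ 1 := by
  rw [fChan_eq, ← law.sum_pathWeight M]
  exact Finset.sum_le_sum fun k _ =>
    mul_le_of_le_one_right (law.pathWeight_nonneg k) (law.condFail_le_one C w k)

lemma received_le {M C : ℕ} (H : Fin M → Fin C → Bool) : received H ≤ M * C := by
  calc received H ≤ ∑ _l : Fin M, ∑ _j : Fin C, 1 :=
      Finset.sum_le_sum fun l _ => Finset.sum_le_sum fun j _ => by split_ifs <;> simp
    _ = M * C := by simp

lemma fChan_eq_one {M C w : ℕ} (hw : M * C < w) : law.fChan M C w = 1 := by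
  rw [fChan_eq, ← law.sum_pathWeight M]
  refine Finset.sum_congr rfl fun k _ => ?_
  have : law.condFail C w k = 1 := by
    rw [condFail, ← law.sum_packetProb (C := C) k]
    exact Finset.sum_congr rfl fun H _ => if_pos ((received_le H).trans_lt hw)
  rw [this, mul_one]

/-- Chernoff's bound for the number of received packets, given the levels of the paths. -/
lemma condFail_le_exp {M : ℕ} (C w : ℕ) (k : Fin M → Fin (law.K + 1)) {s : ℝ} (hs : 0 ≤ s) :
    law.condFail C w k ≤
      Real.exp (s * w - (1 - Real.exp (-s)) * (C * ∑ l, law.p (k l))) := by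
  have h1 : law.condFail C w k ≤ ∑ H : Fin M → Fin C → Bool, Real.exp (s * w) *
      ∏ l, ∏ j, (if H l j then law.p (k l) * Real.exp (-s) else 1 - law.p (k l)) := by
    refine Finset.sum_le_sum fun H _ => ?_
    have h2 : ∏ l, ∏ j, (if H l j then law.p (k l) * Real.exp (-s) else 1 - law.p (k l)) =
        law.packetProb k H * Real.exp (-s * received H) := by
      have : Real.exp (-s * received H) =
          ∏ l, ∏ j, if H l j then Real.exp (-s) else 1 := by
        simp only [received, Nat.cast_sum, Finset.mul_sum, Real.exp_sum]
        refine Finset.prod_congr rfl fun l _ => Finset.prod_congr rfl fun j _ => ?_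
        split_ifs <;> simp
      rw [this, packetProb, ← Finset.prod_mul_distrib]
      refine Finset.prod_congr rfl fun l _ => ?_
      rw [← Finset.prod_mul_distrib]
      refine Finset.prod_congr rfl fun j _ => ?_
      split_ifs <;> simp
    rw [h2, mul_left_comm, ← Real.exp_add]
    split_ifs with h
    · refine le_mul_of_one_le_right (law.packetProb_nonneg k H) (Real.one_le_exp ?_)
      have : (received H : ℝ) ≤ w := by exact_mod_cast h.le
      nlinarith
    · exact mul_nonneg (law.packetProb_nonneg k H) (Real.exp_pos _).le
  refine h1.trans ?_
  rw [← Finset.mul_sum, sum_prod_prod (C := C) fun (l : Fin M) b =>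
    if b then law.p (k l) * Real.exp (-s) else 1 - law.p (k l), sub_eq_add_neg, Real.exp_add]
  refine mul_le_mul_of_nonneg_left ?_ (Real.exp_pos _).le
  have h3 : -((1 - Real.exp (-s)) * (C * ∑ l, law.p (k l))) =
      ∑ l, (C : ℝ) * (-((1 - Real.exp (-s)) * law.p (k l))) := by
    rw [← Finset.mul_sum, Finset.sum_neg_distrib, ← Finset.mul_sum]
    ring
  rw [h3, Real.exp_sum]
  have h4 : ∀ l, 0 ≤ ∑ b, (if b = true then law.p (k l) * Real.exp (-s) else 1 - law.p (k l)) := by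
    intro l
    have := law.p_le_one (k l)
    have := mul_pos (law.p_pos (k l)) (Real.exp_pos (-s))
    simp
    linarith
  refine Finset.prod_le_prod (fun l _ => pow_nonneg (h4 l) _) fun l _ => ?_
  rw [Real.exp_nat_mul]
  refine pow_le_pow_left₀ (h4 l) ?_ _
  have := Real.add_one_le_exp (-((1 - Real.exp (-s)) * law.p (k l)))
  simp
  linarith

/-- The probability that the expected number of packets received in a slot, given the levels of
the paths, is less than `y`. -/
noncomputable def lowLevelProb (M C : ℕ) (y : ℝ) : ℝ :=
  ∑ k : Fin M → Fin (law.K + 1), if C * ∑ l, law.p (k l) < y then ∏ l, law.q (k l) else 0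

/-- Split on whether the conditional mean of received packets reaches `ρ * x`. If it does, Chernoff
with tilt `s = log ρ`, the optimal one at mean `ρ * x` and window `x`, gives the exponent `-(ρ - 1 -
log ρ) * x`. -/
lemma fChan_le (M C w : ℕ) {ρ x : ℝ} (hρ : 1 < ρ) (hw : (w : ℝ) ≤ x) :
    law.fChan M C w ≤
      law.lowLevelProb M C (ρ * x) + Real.exp (-((ρ - 1 - Real.log ρ) * x)) := by
  have hlog : 0 < Real.log ρ := Real.log_pos hρ
  have h0 : 0 < ρ := by linarith
  have h1 : law.lowLevelProb M C (ρ * x) + Real.exp (-((ρ - 1 - Real.log ρ) * x)) =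
      ∑ k : Fin M → Fin (law.K + 1), ((if C * ∑ l, law.p (k l) < ρ * x then ∏ l, law.q (k l) else 0)
        + (∏ l, law.q (k l)) * Real.exp (-((ρ - 1 - Real.log ρ) * x))) := by
    rw [Finset.sum_add_distrib, ← Finset.sum_mul, sum_pathWeight, one_mul]
    rfl
  rw [h1, fChan_eq]
  refine Finset.sum_le_sum fun k _ => ?_
  have hq := law.pathWeight_nonneg k
  split_ifs with h
  · exact (mul_le_of_le_one_right hq (law.condFail_le_one C w k)).trans
      (le_add_of_nonneg_right (mul_nonneg hq (Real.exp_pos _).le))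
  · rw [zero_add]
    refine mul_le_mul_of_nonneg_left ((law.condFail_le_exp C w k hlog.le).trans ?_) hq
    refine Real.exp_le_exp.2 ?_
    rw [Real.exp_neg, Real.exp_log h0]
    have h5 : (1 - ρ⁻¹) * (ρ * x) ≤ (1 - ρ⁻¹) * (C * ∑ l, law.p (k l)) :=
      mul_le_mul_of_nonneg_left (not_lt.1 h) (sub_nonneg.2 (inv_le_one_of_one_le₀ hρ.le))
    have h6 : (1 - ρ⁻¹) * (ρ * x) = (ρ - 1) * x := by field_simp
    have h7 := mul_le_mul_of_nonneg_left hw hlog.le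
    linarith

lemma lowLevelProb_eq_zero (M C : ℕ) {y : ℝ} (hy : y ≤ law.pMin * M * C) :
    law.lowLevelProb M C y = 0 := by
  refine Finset.sum_eq_zero fun k _ => if_neg (not_lt.2 (hy.trans ?_))
  have : ∑ _l : Fin M, law.pMin ≤ ∑ l, law.p (k l) := Finset.sum_le_sum fun l _ => law.pMin_le _
  simp only [Finset.sum_const, Finset.card_univ, Fintype.card_fin, nsmul_eq_mul] at this
  have := mul_le_mul_of_nonneg_left this (Nat.cast_nonneg (α := ℝ) C)
  linarith

lemma lowLevelProb_nonneg (M C : ℕ) (y : ℝ) : 0 ≤ law.lowLevelProb M C y := by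
  refine Finset.sum_nonneg fun k _ => ?_
  split_ifs
  · exact law.pathWeight_nonneg k
  · exact le_rfl

lemma lowLevelProb_le_one (M C : ℕ) (y : ℝ) : law.lowLevelProb M C y ≤ 1 := by
  rw [← law.sum_pathWeight M]
  refine Finset.sum_le_sum fun k _ => ?_
  split_ifs
  · exact le_rfl
  · exact law.pathWeight_nonneg k

/-! ### Large deviations of the path levels -/

lemma lossMgf_pos (θ : ℝ) : 0 < law.lossMgf θ := by
  have h : ∀ k, 0 ≤ law.q k * Real.exp (θ * (1 - law.p k)) :=
    fun k => mul_nonneg (law.q_nonneg k) (Real.exp_pos _).le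
  refine lt_of_le_of_ne (Finset.sum_nonneg fun k _ => h k) fun h0 => ?_
  have h1 := (Finset.sum_eq_zero_iff_of_nonneg fun k _ => h k).1 h0.symm
  have h2 : ∑ k, law.q k = 0 := Finset.sum_eq_zero fun k hk =>
    (mul_eq_zero.1 (h1 k hk)).resolve_right (Real.exp_pos _).ne'
  rw [law.q_sum] at h2
  exact one_ne_zero h2

/-- Jensen's inequality for the moment generating function of the losses. -/
lemma le_log_lossMgf (θ : ℝ) : θ * (1 - law.meanP) ≤ Real.log (law.lossMgf θ) := by
  rw [Real.le_log_iff_exp_le (law.lossMgf_pos θ)]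
  have h := convexOn_exp.map_sum_le (t := Finset.univ) (w := law.q)
    (p := fun k => θ * (1 - law.p k)) (fun k _ => law.q_nonneg k) law.q_sum (fun _ _ => trivial)
  simp only [smul_eq_mul] at h
  refine le_trans (Real.exp_le_exp.2 (le_of_eq ?_)) h
  have : ∀ k, law.q k * (θ * (1 - law.p k)) = θ * (law.q k - law.q k * law.p k) := fun k => by ring
  simp only [this]
  rw [← Finset.mul_sum, Finset.sum_sub_distrib, law.q_sum, meanP]

/-- Markov's inequality for `exp (θ * ∑ (1 - P))` handles `θ ≥ 0`. The rate is a supremum over all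
real `θ`; for `θ ≤ 0` the right side is at least 1 by Jensen, because `y` is at most the mean. -/
lemma lowLevelProb_le_exp {M C : ℕ} (hM : 1 ≤ M) (hC : 1 ≤ C) {y : ℝ}
    (hy : y ≤ law.meanP * M * C) (θ : ℝ) :
    law.lowLevelProb M C y ≤
      Real.exp (-(M * (θ * (1 - y / (M * C)) - Real.log (law.lossMgf θ)))) := by
  have hM0 : (0 : ℝ) < M := by exact_mod_cast hM
  have hC0 : (0 : ℝ) < C := by exact_mod_cast hC
  rcases le_total θ 0 with hθ | hθ
  · refine (law.lowLevelProb_le_one M C y).trans (Real.one_le_exp ?_)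
    have h1 : y / (M * C) ≤ law.meanP := by rw [div_le_iff₀ (by positivity)]; linarith
    have h2 := law.le_log_lossMgf θ
    have h3 : θ * (1 - y / (M * C)) ≤ θ * (1 - law.meanP) :=
      mul_le_mul_of_nonpos_left (by linarith) hθ
    nlinarith
  · have h1 : -(M * (θ * (1 - y / (M * C)) - Real.log (law.lossMgf θ))) =
        -(θ * (M - y / C)) + M * Real.log (law.lossMgf θ) := by field_simp; ring
    rw [h1, Real.exp_add, Real.exp_nat_mul, Real.exp_log (law.lossMgf_pos θ)]
    have h2 : law.lossMgf θ ^ M = ∑ k : Fin M → Fin (law.K + 1),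
        ∏ l, (law.q (k l) * Real.exp (θ * (1 - law.p (k l)))) := by
      rw [← Fintype.prod_sum (fun (_ : Fin M) k => law.q k * Real.exp (θ * (1 - law.p k)))]
      simp [lossMgf]
    rw [h2, Finset.mul_sum]
    refine Finset.sum_le_sum fun k _ => ?_
    rw [Finset.prod_mul_distrib, ← Real.exp_sum, mul_left_comm, ← Real.exp_add]
    split_ifs with h
    · refine le_mul_of_one_le_right (law.pathWeight_nonneg k) (Real.one_le_exp ?_)
      rw [← Finset.mul_sum, Finset.sum_sub_distrib]
      simp only [Finset.sum_const, Finset.card_univ, Fintype.card_fin, nsmul_eq_mul, mul_one]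
      have h3 : ∑ l, law.p (k l) ≤ y / C := by
        rw [le_div_iff₀ hC0]; linarith
      nlinarith
    · exact mul_nonneg (law.pathWeight_nonneg k) (Real.exp_pos _).le

lemma lowLevelProb_le_expNegRate {M C : ℕ} (hM : 1 ≤ M) (hC : 1 ≤ C) {y : ℝ}
    (hy : y ≤ law.meanP * M * C) :
    law.lowLevelProb M C y ≤ law.expNegRate M (1 - y / (M * C)) := by
  have hM0 : (0 : ℝ) < M := by exact_mod_cast hM
  rcases (law.lowLevelProb_nonneg M C y).eq_or_lt with h | h
  · rw [← h]
    exact ENNReal.toReal_nonneg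
  set P := law.lowLevelProb M C y
  set a := 1 - y / (M * C)
  -- A positive probability makes the rate finite: `-log P / M` bounds it above, the value at `θ =
  -- 0` below.
  have h1 : law.rate a ≤ ((-Real.log P / M : ℝ) : EReal) := by
    refine iSup_le fun θ => EReal.coe_le_coe_iff.2 ?_
    have := (Real.log_le_iff_le_exp h).2 (law.lowLevelProb_le_exp hM hC hy θ)
    rw [le_div_iff₀ hM0]
    linarith
  have h2 : ((0 * a - Real.log (law.lossMgf 0) : ℝ) : EReal) ≤ law.rate a :=
    le_iSup (fun θ : ℝ => ((θ * a - Real.log (law.lossMgf θ) : ℝ) : EReal)) 0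
  obtain ⟨r, hr⟩ : ∃ r : ℝ, law.rate a = r :=
    ⟨_, (EReal.coe_toReal (ne_top_of_le_ne_top (EReal.coe_ne_top _) h1)
      (ne_bot_of_le_ne_bot (EReal.coe_ne_bot _) h2)).symm⟩
  rw [hr, EReal.coe_le_coe_iff, le_div_iff₀ hM0] at h1
  rw [expNegRate, hr, ← EReal.coe_mul, ← EReal.coe_neg, EReal.exp_coe,
    ENNReal.toReal_ofReal (Real.exp_pos _).le, ← Real.log_le_iff_le_exp h]
  linarith

end ChannelLaw

/-! ### Stationary distributions of the window chain -/

/-- A finite Markov chain has a stationary distribution. -/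
lemma exists_stationary_of_rowStochastic {ι : Type*} [Fintype ι] [DecidableEq ι] [Nonempty ι]
    {T : Matrix ι ι ℝ} (hT : T ∈ Matrix.rowStochastic ℝ ι) :
    ∃ v : ι → ℝ, (∀ i, 0 ≤ v i) ∧ ∑ i, v i = 1 ∧ ∀ j, ∑ i, v i * T i j = v j := by
  obtain ⟨hT0, hT1⟩ := Matrix.mem_rowStochastic_iff_sum.1 hT
  have hdet : (1 - T).det = 0 := by
    refine Matrix.exists_mulVec_eq_zero_iff.1 ⟨1, one_ne_zero, ?_⟩
    rw [Matrix.sub_mulVec, Matrix.one_vecMul_of_mem_rowStochastic hT, Matrix.one_mulVec, sub_self]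
  obtain ⟨u, hu0, hu⟩ := Matrix.exists_vecMul_eq_zero_iff.2 hdet
  have hu1 : ∀ j, ∑ i, u i * T i j = u j := by
    intro j
    have := congrFun hu j
    rw [Matrix.vecMul_sub, Matrix.vecMul_one] at this
    exact (sub_eq_zero.1 this).symm
  -- A left fixed vector `u` may change sign. But `|u| ≤ |u| T` entrywise with equal total mass, so
  -- equality holds and `|u|` can be normalised.
  have hle : ∀ j ∈ Finset.univ, |u j| ≤ ∑ i, |u i| * T i j := by
    intro j _
    rw [← hu1 j]
    refine (Finset.abs_sum_le_sum_abs _ _).trans (le_of_eq ?_)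
    refine Finset.sum_congr rfl fun i _ => ?_
    rw [abs_mul, abs_of_nonneg (hT0 i j)]
  have hsum : ∑ j, |u j| = ∑ j, ∑ i, |u i| * T i j := by
    rw [Finset.sum_comm]
    simp [← Finset.mul_sum, hT1]
  have heq := (Finset.sum_eq_sum_iff_of_le hle).1 hsum
  have hpos : 0 < ∑ j, |u j| := by
    obtain ⟨i, hi⟩ := Function.ne_iff.1 hu0
    exact Finset.sum_pos' (fun _ _ => abs_nonneg _) ⟨i, Finset.mem_univ i, abs_pos.2 hi⟩
  refine ⟨fun i => |u i| / ∑ j, |u j|, fun i => by positivity, ?_, fun j => ?_⟩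
  · rw [← Finset.sum_div, div_self hpos.ne']
  · simp only [div_mul_eq_mul_div]
    rw [← Finset.sum_div, ← heq j (Finset.mem_univ j)]

namespace ChannelLaw

variable (law : ChannelLaw)

lemma fEff_nonneg {M C : ℕ} {f : ℕ → ℝ} (hf : IsAQM f) (w : ℕ) : 0 ≤ law.fEff M C f w := by
  have h1 := hf w
  have h2 := law.fChan_nonneg M C w
  have h3 := law.fChan_le_one M C w
  have := mul_le_one₀ (sub_le_self 1 h1.1) (sub_nonneg.2 h3) (sub_le_self 1 h2)
  simp only [fEff]
  linarith

lemma fEff_le_one {M C : ℕ} {f : ℕ → ℝ} (hf : IsAQM f) (w : ℕ) : law.fEff M C f w ≤ 1 :=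
  sub_le_self 1 (mul_nonneg (sub_nonneg.2 (hf w).2) (sub_nonneg.2 (law.fChan_le_one M C w)))

lemma fEff_eq_one {M C w : ℕ} (f : ℕ → ℝ) (hw : M * C < w) : law.fEff M C f w = 1 := by
  simp [fEff, law.fChan_eq_one hw]

lemma trans_nonneg {M C : ℕ} {f : ℕ → ℝ} (hf : IsAQM f) (w w' : ℕ) :
    0 ≤ law.trans M C f w w' := by
  have h1 := law.fEff_nonneg (M := M) (C := C) hf w
  have h2 := law.fEff_le_one (M := M) (C := C) hf w
  refine add_nonneg ?_ ?_ <;> split_ifs <;> linarith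

/-- Certain halving at `N` confines the chain to `1..N`: the value `V (N + 1)` outside the range
only occurs with coefficient zero. -/
lemma sum_trans_mul {M C : ℕ} (f : ℕ → ℝ) {N w : ℕ} (hN : law.fEff M C f N = 1)
    (hw : w ∈ Finset.Icc 1 N) (V : ℕ → ℝ) :
    ∑ w' ∈ Finset.Icc 1 N, law.trans M C f w w' * V w' =
      (1 - law.fEff M C f w) * V (w + 1) + law.fEff M C f w * V ((w + 1) / 2) := by
  rw [Finset.mem_Icc] at hw
  simp only [trans, add_mul, ite_mul, zero_mul, Finset.sum_add_distrib, Finset.sum_ite_eq',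
    Finset.mem_Icc]
  rw [if_pos (show 1 ≤ (w + 1) / 2 ∧ (w + 1) / 2 ≤ N by omega)]
  congr 1
  split_ifs with h
  · rfl
  · obtain rfl : w = N := by omega
    rw [hN, sub_self, zero_mul]

lemma trans_eq_zero {M C : ℕ} (f : ℕ → ℝ) {N w w' : ℕ} (hN : law.fEff M C f N = 1)
    (hw : w ∈ Finset.Icc 1 N) (hw' : w' ∉ Finset.Icc 1 N) : law.trans M C f w w' = 0 := by
  rw [Finset.mem_Icc] at hw hw'
  rw [trans, if_neg (show ¬ w' = (w + 1) / 2 by omega), add_zero]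
  split_ifs with h
  · obtain rfl : w = N := by omega
    rw [hN, sub_self]
  · rfl

/-- A distribution that lives on a finite set of windows is stationary if the finitely many
balance equations hold. -/
lemma isStationary_iff_of_support {M C : ℕ} {f π : ℕ → ℝ} {N : ℕ}
    (hπ : ∀ w ∉ Finset.Icc 1 N, π w = 0) :
    law.IsStationary M C f π ↔ (∀ w, 0 ≤ π w) ∧ ∑ w ∈ Finset.Icc 1 N, π w = 1 ∧
      ∀ w', ∑ w ∈ Finset.Icc 1 N, π w * law.trans M C f w w' = π w' := by
  have h1 : HasSum π (∑ w ∈ Finset.Icc 1 N, π w) := hasSum_sum_of_ne_finset_zero hπ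
  have h2 : ∀ w', HasSum (fun w => π w * law.trans M C f w w')
      (∑ w ∈ Finset.Icc 1 N, π w * law.trans M C f w w') := fun w' =>
    hasSum_sum_of_ne_finset_zero fun w hw => by rw [hπ w hw, zero_mul]
  constructor
  · rintro ⟨h0, _, hs, hi⟩
    exact ⟨h0, h1.unique hs, fun w' => (h2 w').unique (hi w')⟩
  · rintro ⟨h0, hs, hi⟩
    exact ⟨h0, hπ 0 (by simp), hs ▸ h1, fun w' => by simpa only [hi w'] using h2 w'⟩

lemma exists_isStationary {M C : ℕ} {f : ℕ → ℝ} (hf : IsAQM f) {N : ℕ} (h1 : 1 ≤ N)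
    (hN : law.fEff M C f N = 1) :
    ∃ π, law.IsStationary M C f π ∧ ∀ w ∉ Finset.Icc 1 N, π w = 0 := by
  have : Nonempty (Finset.Icc 1 N) := ⟨⟨1, by simpa using h1⟩⟩
  obtain ⟨v, hv0, hv1, hv⟩ := exists_stationary_of_rowStochastic
    (T := Matrix.of fun w w' : Finset.Icc 1 N => law.trans M C f w w') <| by
      refine Matrix.mem_rowStochastic_iff_sum.2 ⟨fun w w' => law.trans_nonneg hf w w', fun w => ?_⟩
      have := law.sum_trans_mul f hN w.2 fun _ => 1
      simp only [mul_one] at this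
      simp only [Matrix.of_apply]
      rw [Finset.sum_coe_sort (Finset.Icc 1 N) fun w' => law.trans M C f w w', this]
      ring
  let π : ℕ → ℝ := fun w => if h : w ∈ Finset.Icc 1 N then v ⟨w, h⟩ else 0
  have hπv : ∀ w : Finset.Icc 1 N, π w = v w := fun w => dif_pos w.2
  have hπ : ∀ w ∉ Finset.Icc 1 N, π w = 0 := fun w hw => dif_neg hw
  refine ⟨π, (law.isStationary_iff_of_support hπ).2 ⟨fun w => ?_, ?_, fun w' => ?_⟩, hπ⟩
  · by_cases h : w ∈ Finset.Icc 1 N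
    · exact (hv0 ⟨w, h⟩).trans_eq (hπv ⟨w, h⟩).symm
    · exact (hπ w h).ge
  · rw [← Finset.sum_coe_sort, ← hv1]
    exact Finset.sum_congr rfl fun w _ => hπv w
  · by_cases h : w' ∈ Finset.Icc 1 N
    · rw [← Finset.sum_coe_sort (Finset.Icc 1 N) fun w => π w * law.trans M C f w w',
        hπv ⟨w', h⟩, ← hv]
      exact Finset.sum_congr rfl fun w _ => by rw [hπv w]; rfl
    · rw [hπ w' h]
      exact Finset.sum_eq_zero fun w hw => by rw [law.trans_eq_zero f hN hw h, mul_zero]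

/-- Stationarity, tested against a function of the window. -/
lemma IsStationary.sum_mul_eq {M C : ℕ} {f π : ℕ → ℝ} {N : ℕ} (hN : law.fEff M C f N = 1)
    (hs : law.IsStationary M C f π) (hπ : ∀ w ∉ Finset.Icc 1 N, π w = 0) (V : ℕ → ℝ) :
    ∑ w ∈ Finset.Icc 1 N, π w * V w = ∑ w ∈ Finset.Icc 1 N, π w *
      ((1 - law.fEff M C f w) * V (w + 1) + law.fEff M C f w * V ((w + 1) / 2)) := by
  have hi := ((law.isStationary_iff_of_support hπ).1 hs).2.2
  calc ∑ w' ∈ Finset.Icc 1 N, π w' * V w'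
      = ∑ w' ∈ Finset.Icc 1 N, ∑ w ∈ Finset.Icc 1 N, π w * law.trans M C f w w' * V w' :=
        Finset.sum_congr rfl fun w' _ => by rw [← Finset.sum_mul, hi]
    _ = _ := by
        rw [Finset.sum_comm]
        refine Finset.sum_congr rfl fun w hw => ?_
        rw [← law.sum_trans_mul f hN hw, Finset.mul_sum]
        exact Finset.sum_congr rfl fun w' _ => by ring

/-! ### Mean window under a threshold AQM -/

/-- The AQM that marks exactly the windows `w ≥ N`. -/
noncomputable def thresholdAQM (N w : ℕ) : ℝ := if N ≤ w then 1 else 0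

lemma isAQM_thresholdAQM (N : ℕ) : IsAQM (thresholdAQM N) := fun w => by
  unfold thresholdAQM
  split_ifs <;> norm_num

lemma fEff_thresholdAQM_self (M C N : ℕ) : law.fEff M C (thresholdAQM N) N = 1 := by
  simp [fEff, thresholdAQM]

lemma fEff_thresholdAQM_of_lt (M C : ℕ) {N w : ℕ} (hw : w < N) :
    law.fEff M C (thresholdAQM N) w = law.fChan M C w := by
  simp [fEff, thresholdAQM, hw.not_ge]

/-- The mean window under a threshold AQM, if the channel fails with probability at most `ε`
below the threshold. -/
lemma exists_mem_meanWindows (M C : ℕ) {N : ℕ} (h1 : 1 ≤ N) {ε : ℝ}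
    (hε : ∀ w < N, law.fChan M C w ≤ ε) :
    ∃ m ∈ law.meanWindows M C, 0 ≤ m ∧ m ≤ N ∧
      (1.5 * N + 1) * (1 - ε * (1 + m / 2)) ≤ 2 * m + 1 := by
  have hN := law.fEff_thresholdAQM_self M C N
  obtain ⟨π, hs, hπ⟩ := law.exists_isStationary (isAQM_thresholdAQM N) h1 hN
  have hε0 : 0 ≤ ε := (law.fChan_nonneg M C 0).trans (hε 0 h1)
  obtain ⟨hπ0, hπ1, -⟩ := (law.isStationary_iff_of_support hπ).1 hs
  have hNmem : N ∈ Finset.Icc 1 N := Finset.mem_Icc.2 ⟨h1, le_rfl⟩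
  set e := law.fEff M C (thresholdAQM N)
  have he0 : ∀ w, 0 ≤ e w := law.fEff_nonneg (isAQM_thresholdAQM N)
  set m := ∑ w ∈ Finset.Icc 1 N, (w : ℝ) * π w with hm
  have hm' : ∑ w ∈ Finset.Icc 1 N, π w * (w : ℝ) = m :=
    Finset.sum_congr rfl fun w _ => mul_comm _ _
  have hhalf : ∀ w : ℕ, (w : ℝ) ≤ 2 * ((w + 1) / 2 : ℕ) ∧ ((w + 1) / 2 : ℕ) ≤ (w : ℝ) := fun w =>
    ⟨by exact_mod_cast (by omega : w ≤ 2 * ((w + 1) / 2)),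
      by exact_mod_cast (by omega : (w + 1) / 2 ≤ w)⟩
  have hI1 := hs.sum_mul_eq law hN hπ fun w => (w : ℝ)
  have hI2 := hs.sum_mul_eq law hN hπ fun w => (w : ℝ) ^ 2
  have hJ1 : ∑ w ∈ Finset.Icc 1 N, π w * (e w * (w + 1 - ((w + 1) / 2 : ℕ))) = 1 := by
    have : ∑ w ∈ Finset.Icc 1 N, π w * (e w * (w + 1 - ((w + 1) / 2 : ℕ))) =
        ∑ w ∈ Finset.Icc 1 N, π w * (w : ℝ) + ∑ w ∈ Finset.Icc 1 N, π w
        - ∑ w ∈ Finset.Icc 1 N, π w *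
          ((1 - e w) * ((w + 1 : ℕ) : ℝ) + e w * ((w + 1) / 2 : ℕ)) := by
      rw [← Finset.sum_add_distrib, ← Finset.sum_sub_distrib]
      refine Finset.sum_congr rfl fun w _ => ?_
      push_cast
      ring
    rw [this, ← hI1, hπ1]
    ring
  have hJ2 : ∑ w ∈ Finset.Icc 1 N, π w * (e w * (((w : ℝ) + 1) ^ 2 - ((w + 1) / 2 : ℕ) ^ 2)) =
      2 * m + 1 := by
    have : ∑ w ∈ Finset.Icc 1 N, π w * (e w * (((w : ℝ) + 1) ^ 2 - ((w + 1) / 2 : ℕ) ^ 2)) =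
        ∑ w ∈ Finset.Icc 1 N, π w * (w : ℝ) ^ 2 + 2 * ∑ w ∈ Finset.Icc 1 N, π w * (w : ℝ)
        + ∑ w ∈ Finset.Icc 1 N, π w
        - ∑ w ∈ Finset.Icc 1 N, π w *
          ((1 - e w) * ((w + 1 : ℕ) : ℝ) ^ 2 + e w * ((w + 1) / 2 : ℕ) ^ 2) := by
      rw [Finset.mul_sum, ← Finset.sum_add_distrib, ← Finset.sum_add_distrib,
        ← Finset.sum_sub_distrib]
      refine Finset.sum_congr rfl fun w _ => ?_
      push_cast
      ring
    rw [this, ← hI2, hπ1, hm']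
    ring
  set g : ℝ := N + 1 - ((N + 1) / 2 : ℕ) with hg
  -- In the first-moment identity, a state `w < N` contributes at most `π w * ε * (1 + w / 2)`.
  have hK1 : 1 ≤ π N * g + ε * (1 + m / 2) := by
    have h2 : π N * g + ε * (1 + m / 2) = ∑ w ∈ Finset.Icc 1 N,
        ((if w = N then π N * g else 0) + ε * (π w + π w * w / 2)) := by
      rw [Finset.sum_add_distrib, Finset.sum_ite_eq', if_pos hNmem, ← Finset.mul_sum,
        Finset.sum_add_distrib, ← Finset.sum_div, hm', hπ1]
    rw [h2, ← hJ1]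
    refine Finset.sum_le_sum fun w hw => ?_
    have hw2 := hhalf w
    have hpw := hπ0 w
    split_ifs with hwN
    · rw [hwN, show e N = 1 from hN, one_mul]
      have := hπ0 N
      exact le_add_of_nonneg_right (by positivity)
    · have hlt : w < N := lt_of_le_of_ne (Finset.mem_Icc.1 hw).2 hwN
      have h3 : e w ≤ ε := (law.fEff_thresholdAQM_of_lt M C hlt).trans_le (hε w hlt)
      have h4 : e w * (w + 1 - ((w + 1) / 2 : ℕ)) ≤ ε * (1 + w / 2) :=
        mul_le_mul h3 (by linarith [hw2.1]) (by linarith [hw2.2]) hε0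
      have := mul_le_mul_of_nonneg_left h4 hpw
      linarith
  -- Only the state `N` is kept in the second-moment identity; the difference of squares factors as
  -- `g` times `N + 1 + ⌈N/2⌉`.
  have hK2 : π N * g * (1.5 * N + 1) ≤ 2 * m + 1 := by
    rw [← hJ2]
    refine le_trans ?_ (Finset.single_le_sum (f := fun w => π w * (e w * (((w : ℝ) + 1) ^ 2 -
      ((w + 1) / 2 : ℕ) ^ 2))) (fun w _ => ?_) hNmem)
    · have h2 := hhalf N
      have h3 : 0 ≤ π N * g := mul_nonneg (hπ0 N) (by linarith [h2.2])
      have h4 : (1.5 * N + 1 : ℝ) ≤ N + 1 + ((N + 1) / 2 : ℕ) := by linarith [h2.1]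
      refine (mul_le_mul_of_nonneg_left h4 h3).trans (le_of_eq ?_)
      rw [show e N = 1 from hN, hg]
      ring
    · refine mul_nonneg (hπ0 w) (mul_nonneg (he0 w) (sub_nonneg.2 ?_))
      exact pow_le_pow_left₀ (by positivity) (by linarith [(hhalf w).2]) 2
  refine ⟨m, ⟨thresholdAQM N, π, isAQM_thresholdAQM N, hs,
    hasSum_sum_of_ne_finset_zero fun w hw => by rw [hπ w hw, mul_zero]⟩, ?_, ?_, ?_⟩
  · exact Finset.sum_nonneg fun w _ => mul_nonneg (Nat.cast_nonneg w) (hπ0 w)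
  · calc m ≤ ∑ w ∈ Finset.Icc 1 N, (N : ℝ) * π w := Finset.sum_le_sum fun w hw =>
        mul_le_mul_of_nonneg_right (by exact_mod_cast (Finset.mem_Icc.1 hw).2) (hπ0 w)
      _ = N := by rw [← Finset.mul_sum, hπ1, mul_one]
  · have h2 : (0 : ℝ) ≤ 1.5 * N + 1 := by positivity
    have := mul_le_mul_of_nonneg_left (sub_le_iff_le_add.2 hK1) h2
    linarith

/-! ### Existence of an optimal AQM -/

/-- Windows that exceed the number of transmitted packets by more than one have probability zero
in equilibrium. -/
lemma IsStationary.eq_zero {M C : ℕ} {f π : ℕ → ℝ} (hs : law.IsStationary M C f π) :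
    ∀ w ∉ Finset.Icc 1 (M * C + 1), π w = 0 := by
  intro w hw
  rcases Nat.eq_zero_or_pos w with rfl | hw0
  · exact hs.zero
  have hwN : M * C + 2 ≤ w := by
    rw [Finset.mem_Icc] at hw
    omega
  -- A state `v ≥ w` is entered only by halving `2v - 1` or `2v`. Summing over `v ≥ w` equates the
  -- masses of `[w, ∞)` and `[2w - 1, ∞)`, so `[w, 2w - 1)`, which contains `w` as `w ≥ 2`, has mass
  -- zero.
  have hbal : ∀ j, π (j + w) = π (2 * j + (w - 1) + w) + π (2 * j + 1 + (w - 1) + w) := by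
    intro j
    refine (hs.invariant (j + w)).unique ?_
    have h1 : ∀ v, M * C < v → π v * law.trans M C f v (j + w) =
        if j + w = (v + 1) / 2 then π v else 0 := by
      intro v hv
      rw [trans, law.fEff_eq_one f hv]
      simp
    have h2 := hasSum_sum_of_ne_finset_zero (f := fun v => π v * law.trans M C f v (j + w))
      (s := {2 * j + (w - 1) + w, 2 * j + 1 + (w - 1) + w}) (L := .unconditional ℕ) (by
        intro v hv
        simp only [Finset.mem_insert, Finset.mem_singleton, not_or] at hv
        by_cases hvM : M * C < v
        · rw [h1 v hvM, if_neg (by omega)]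
        · rw [trans, if_neg (by omega), if_neg (by omega), add_zero, mul_zero])
    rw [Finset.sum_pair (by omega), h1 _ (by omega), h1 _ (by omega), if_pos (by omega),
      if_pos (by omega)] at h2
    exact h2
  have hsum : Summable fun j => π (j + w) := (summable_nat_add_iff w).2 hs.hasSum_one.summable
  have hsum' : Summable fun j => π (j + (w - 1) + w) :=
    (summable_nat_add_iff (f := fun j => π (j + w)) (w - 1)).2 hsum
  have h3 : ∑' j, π (j + w) = ∑' j, π (j + (w - 1) + w) := by
    have hev : Summable fun j => π (2 * j + (w - 1) + w) :=
      hsum'.comp_injective (i := fun j => 2 * j) fun a b h => by simpa using h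
    have hod : Summable fun j => π (2 * j + 1 + (w - 1) + w) :=
      hsum'.comp_injective (i := fun j => 2 * j + 1) fun a b h => by simpa using h
    rw [← tsum_even_add_odd (f := fun j => π (j + (w - 1) + w)) hev hod, ← hev.tsum_add hod]
    exact tsum_congr hbal
  have h4 := hsum.sum_add_tsum_nat_add (w - 1)
  have h5 : ∑ j ∈ Finset.range (w - 1), π (j + w) = 0 := by linarith
  have h6 := (Finset.sum_eq_zero_iff_of_nonneg fun j _ => hs.nonneg (j + w)).1 h5 0
    (Finset.mem_range.2 (by omega))
  simpa using h6

lemma isCompact_meanWindows (M C : ℕ) : IsCompact (law.meanWindows M C) := by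
  set S := Finset.Icc 1 (M * C + 1)
  let U : Set (ℕ → ℝ) := Set.pi Set.univ fun _ => Set.Icc 0 1
  have hU : IsCompact U := isCompact_univ_pi fun _ => isCompact_Icc
  let K : Set ((ℕ → ℝ) × (ℕ → ℝ)) := {x | ∀ w ∉ S, x.2 w = 0} ∩ ({x | ∑ w ∈ S, x.2 w = 1} ∩
    {x | ∀ w', ∑ w ∈ S, x.2 w * law.trans M C x.1 w w' = x.2 w'})
  have hK : IsClosed K := by
    have htrans : ∀ w w', Continuous fun x : (ℕ → ℝ) × (ℕ → ℝ) => law.trans M C x.1 w w' := by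
      intro w w'
      unfold trans fEff
      split_ifs <;> fun_prop
    refine IsClosed.inter ?_ (IsClosed.inter ?_ ?_)
    · simp only [Set.ofPred_forall]
      exact isClosed_iInter fun w => isClosed_iInter fun _ =>
        isClosed_eq (by fun_prop) continuous_const
    · exact isClosed_eq (by fun_prop) continuous_const
    · simp only [Set.ofPred_forall]
      exact isClosed_iInter fun w' => isClosed_eq (by fun_prop) (by fun_prop)
  have hcont : Continuous fun x : (ℕ → ℝ) × (ℕ → ℝ) => ∑ w ∈ S, (w : ℝ) * x.2 w := by fun_prop
  convert ((hU.prod hU).inter_right hK).image hcont using 1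
  have hmean : ∀ π : ℕ → ℝ, (∀ w ∉ S, π w = 0) →
      HasSum (fun w : ℕ => (w : ℝ) * π w) (∑ w ∈ S, (w : ℝ) * π w) := fun π hπ =>
    hasSum_sum_of_ne_finset_zero fun w hw => by rw [hπ w hw, mul_zero]
  ext m
  constructor
  · rintro ⟨f, π, hf, hs, hm⟩
    have hπ := hs.eq_zero
    obtain ⟨h0, h1, hi⟩ := (law.isStationary_iff_of_support hπ).1 hs
    exact ⟨(f, π), ⟨⟨fun w _ => hf w, fun w _ => ⟨h0 w, le_hasSum hs.hasSum_one w fun v _ => h0 v⟩⟩,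
      hπ, h1, hi⟩, (hmean π hπ).unique hm⟩
  · rintro ⟨⟨f, π⟩, ⟨⟨hf, h0⟩, hπ, h1, hi⟩, rfl⟩
    exact ⟨f, π, fun w => hf w trivial, (law.isStationary_iff_of_support hπ).2
      ⟨fun w => (h0 w trivial).1, h1, hi⟩, hmean π hπ⟩

lemma le_of_mem_meanWindows {M C : ℕ} {m : ℝ} (hm : m ∈ law.meanWindows M C) :
    m ≤ M * C + 1 := by
  obtain ⟨f, π, _, hs, hm⟩ := hm
  have h := hs.hasSum_one.mul_left ((M : ℝ) * C + 1)
  rw [mul_one] at h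
  refine hasSum_le (fun w => ?_) hm h
  by_cases hw : w ∈ Finset.Icc 1 (M * C + 1)
  · exact mul_le_mul_of_nonneg_right (by exact_mod_cast (Finset.mem_Icc.1 hw).2) (hs.nonneg w)
  · rw [hs.eq_zero law w hw, mul_zero, mul_zero]

lemma isGreatest_optimalMeanWindow (M C : ℕ) :
    IsGreatest (law.meanWindows M C) (law.optimalMeanWindow M C) := by
  obtain ⟨m, hm, -⟩ := law.exists_mem_meanWindows M C le_rfl fun w _ => law.fChan_le_one M C w
  exact (law.isCompact_meanWindows M C).isGreatest_sSup ⟨m, hm⟩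

/-! ### Quantitative lower bounds -/

lemma exists_tail_bound {κ : ℝ} (hκ : 0 < κ) :
    ∃ X : ℝ, 100 ≤ X ∧ ∀ x, X ≤ x → Real.exp (-(κ * x)) * (8 * x ^ 2) ≤ 1 := by
  have h := (Real.tendsto_pow_mul_exp_neg_atTop_nhds_zero 2).comp
    (tendsto_id.const_mul_atTop hκ)
  have h2 := h.eventually (ge_mem_nhds (show (0 : ℝ) < κ ^ 2 / 8 by positivity))
  obtain ⟨X, hX⟩ := eventually_atTop.1 h2
  refine ⟨max X 100, le_max_right _ _, fun x hx => ?_⟩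
  have h3 := hX x ((le_max_left _ _).trans hx)
  simp only [Function.comp, id] at h3
  have h4 : 0 < κ ^ 2 := by positivity
  refine le_of_mul_le_mul_left ?_ h4
  calc κ ^ 2 * (Real.exp (-(κ * x)) * (8 * x ^ 2)) = 8 * ((κ * x) ^ 2 * Real.exp (-(κ * x))) := by
        ring
    _ ≤ κ ^ 2 * 1 := by linarith

/-- The bound without path diversity. -/
lemma pMin_bound {ρ : ℝ} (hρ : 1 < ρ) {M C : ℕ} {x : ℝ}
    (hx : x = law.pMin * M * C / ρ ^ 2) (h100 : 100 ≤ x)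
    (htail : Real.exp (-((ρ - 1 - Real.log ρ) * x)) * (8 * x ^ 2) ≤ 1) :
    0.75 * x - 1 ≤ law.optimalMeanWindow M C := by
  set t := Real.exp (-((ρ - 1 - Real.log ρ) * x))
  have ht : 0 ≤ t := (Real.exp_pos _).le
  have hx0 : 0 ≤ x := by linarith
  have hN1 : (⌊x⌋₊ : ℝ) ≤ x := Nat.floor_le hx0
  have hN2 : x < ⌊x⌋₊ + 1 := Nat.lt_floor_add_one x
  have h1 : 1 ≤ ⌊x⌋₊ := (Nat.one_le_floor_iff x).2 (by linarith)
  have hfc : ∀ w < ⌊x⌋₊, law.fChan M C w ≤ t := by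
    intro w hw
    have hwx : (w : ℝ) ≤ x := le_trans (by exact_mod_cast hw.le) hN1
    refine (law.fChan_le M C w hρ hwx).trans ?_
    rw [law.lowLevelProb_eq_zero M C, zero_add]
    rw [hx, ← mul_div_assoc, div_le_iff₀ (by positivity)]
    have h0 : 0 ≤ law.pMin * M * C := by have := law.pMin_pos; positivity
    nlinarith [mul_nonneg h0 (mul_nonneg (by linarith : 0 ≤ ρ) (by linarith : 0 ≤ ρ - 1))]
  obtain ⟨m, hm, hm0, hmN, hineq⟩ := law.exists_mem_meanWindows M C h1 hfc
  refine le_trans ?_ ((law.isGreatest_optimalMeanWindow M C).2 hm)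
  -- The factor 8 in the tail bound is there for this 1/2. It yields `m ≥ 0.75⌊x⌋ - 0.25`, and
  -- rounding costs the other 0.75 of the loss of 1.
  have h2 : (1.5 * (⌊x⌋₊ : ℝ) + 1) * (t * (1 + m / 2)) ≤ 1 / 2 := by
    have h3 : (1.5 * (⌊x⌋₊ : ℝ) + 1) * (1 + m / 2) ≤ (2 * x) * (2 * x) := by
      refine mul_le_mul ?_ ?_ (by positivity) (by positivity) <;> linarith
    have := mul_le_mul_of_nonneg_left h3 ht
    linarith
  linarith

/-- The bound with path diversity, up to windows at which the channel fails about as often as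
the window would be halved anyway. -/
lemma diversity_bound {ρ : ℝ} (hρ : 1 < ρ) {M C : ℕ} (hM : 1 ≤ M) (hC : 1 ≤ C) {β : ℝ}
    (hβ : β ≤ law.meanP * M * C / ρ ^ 2) (h100 : 100 ≤ β)
    (htail : Real.exp (-((ρ - 1 - Real.log ρ) * β)) * (8 * β ^ 2) ≤ 1)
    (hrate : law.expNegRate M (1 - ρ * β / (M * C)) ≤ 1 / β) :
    0.27 * β ≤ law.optimalMeanWindow M C := by
  set t := Real.exp (-((ρ - 1 - Real.log ρ) * β))
  have hβ0 : 0 < β := by linarith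
  have hN1 : (⌊β⌋₊ : ℝ) ≤ β := Nat.floor_le hβ0.le
  have hN2 : β < ⌊β⌋₊ + 1 := Nat.lt_floor_add_one β
  have h1 : 1 ≤ ⌊β⌋₊ := (Nat.one_le_floor_iff β).2 (by linarith)
  have ht : t ≤ 1 / β := by
    rw [le_div_iff₀ hβ0]
    refine le_trans (mul_le_mul_of_nonneg_left ?_ (Real.exp_pos _).le) htail
    nlinarith
  have hfc : ∀ w < ⌊β⌋₊, law.fChan M C w ≤ 2 / β := by
    intro w hw
    have hwx : (w : ℝ) ≤ β := le_trans (by exact_mod_cast hw.le) hN1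
    have h2 : ρ * β ≤ law.meanP * M * C := by
      rw [le_div_iff₀ (by positivity)] at hβ
      nlinarith [mul_nonneg hβ0.le (mul_nonneg (by linarith : 0 ≤ ρ) (by linarith : 0 ≤ ρ - 1))]
    have h3 := law.lowLevelProb_le_expNegRate hM hC h2
    have h4 : 2 / β = 1 / β + 1 / β := by ring
    exact (law.fChan_le M C w hρ hwx).trans (h4 ▸ add_le_add (h3.trans hrate) ht)
  obtain ⟨m, hm, hm0, hmN, hineq⟩ := law.exists_mem_meanWindows M C h1 hfc
  refine le_trans ?_ ((law.isGreatest_optimalMeanWindow M C).2 hm)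
  -- Hence `1.5⌊β⌋ ≤ 3.55m + 3.1`; the slope `1.5/3.55 > 0.42` leaves room for the constants once `β
  -- ≥ 100`.
  have h2 : (1.5 * (⌊β⌋₊ : ℝ) + 1) * (2 / β * (1 + m / 2)) ≤ 3.1 * (1 + m / 2) := by
    rw [← mul_assoc]
    refine mul_le_mul_of_nonneg_right ?_ (by positivity)
    rw [mul_div_assoc', div_le_iff₀ hβ0]
    linarith
  linarith

end ChannelLaw

end TCPRLC

theorem mainTheorem1 (law : TCPRLC.ChannelLaw) (ρ : ℝ) (hρ : 1 < ρ) :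
    ∃ (δ₁ δ₂ : ℕ → ℝ) (C₀ : ℕ) (c₁ c₂ : ℝ),
      Tendsto δ₁ atTop (𝓝 0) ∧ Tendsto δ₂ atTop (𝓝 0) ∧ 0 < c₁ ∧ 0 < c₂ ∧
      ∀ M C : ℕ, 1 ≤ M → C₀ ≤ C →
        -- an optimal AQM exists
        IsGreatest (law.meanWindows M C) (law.optimalMeanWindow M C) ∧
        -- the bound that needs no path diversity
        0.75 * law.pMin * M * C / ρ ^ 2 - 1 ≤ law.optimalMeanWindow M C ∧
        -- the bound when the equation for `β` has a solution
        (∀ β : ℝ, law.pMin * M * C / ρ ^ 2 ≤ β → β ≤ law.meanP * M * C / ρ ^ 2 →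
          1 / β = law.expNegRate M (1 - ρ * β / (M * C)) →
          max (0.75 * law.pMin * M * C / ρ ^ 2 - 1)
              (min (law.meanP * M * C / ρ ^ 2 * (1 - 3 * δ₁ C - 2 * (Real.exp (-1) + δ₂ C)))
                (β * (1 - 3 * (⌊β⌋ : ℝ)⁻¹ - 2 * (Real.exp (-1) + δ₂ C))))
            ≤ law.optimalMeanWindow M C) ∧
        -- the bound when there is no solution because there are enough paths for full diversity
        (∀ B : ℝ, B = law.meanP * M * C / ρ ^ 2 →
          law.expNegRate M (1 - ρ * B / (M * C)) < 1 / B →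
          max (0.75 * law.pMin * M * C / ρ ^ 2 - 1)
              (B * (1 - 3 * δ₁ C - 2 * (Real.exp (-1) + δ₂ C)))
            ≤ law.optimalMeanWindow M C) ∧
        -- the order of the throughput
        c₁ * (law.meanP * M * C) ≤ law.optimalMeanWindow M C ∧
        law.optimalMeanWindow M C ≤ c₂ * (law.meanP * M * C) := by
  have hρ0 : 0 < ρ := by linarith
  have hκ : 0 < ρ - 1 - Real.log ρ := by
    have := Real.log_lt_sub_one_of_pos hρ0 hρ.ne'
    linarith
  obtain ⟨X, hX, htail⟩ := TCPRLC.ChannelLaw.exists_tail_bound hκ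
  have hp := law.pMin_pos
  have hE := law.meanP_pos
  -- `C₀` makes `p₁MC/ρ² ≥ X` for every `M ≥ 1`, and its `+ 1` ensures `C ≥ 1`. `c₁` comes from `x/2
  -- ≤ 0.75x - 1` and `E[P] ≤ 1`, `c₂` from `MC + 1 ≤ 2MC`.
  refine ⟨fun _ => 0, fun _ => 0, ⌈X * ρ ^ 2 / law.pMin⌉₊ + 1, law.pMin / (2 * ρ ^ 2),
    2 / law.meanP, tendsto_const_nhds, tendsto_const_nhds, by positivity, by positivity, ?_⟩
  intro M C hM hC
  have hM' : (1 : ℝ) ≤ M := by exact_mod_cast hM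
  have hC1 : 1 ≤ C := by omega
  have hC' : (1 : ℝ) ≤ C := by exact_mod_cast hC1
  have hMC : (C : ℝ) ≤ M * C := le_mul_of_one_le_left (by linarith) hM'
  obtain ⟨x, hx⟩ : ∃ x, x = law.pMin * M * C / ρ ^ 2 := ⟨_, rfl⟩
  have hXx : X ≤ x := by
    have h1 : X * ρ ^ 2 / law.pMin ≤ C :=
      (Nat.le_ceil _).trans (by exact_mod_cast (Nat.le_succ _).trans hC)
    rw [div_le_iff₀ hp] at h1
    rw [hx, le_div_iff₀ (by positivity)]
    nlinarith
  have hpE : x ≤ law.meanP * M * C / ρ ^ 2 := by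
    rw [hx]
    have := law.pMin_le_meanP
    gcongr
  have h75 : 0.75 * law.pMin * M * C / ρ ^ 2 = 0.75 * x := by rw [hx]; ring
  have hexp := Real.exp_neg_one_gt_d9
  have hmin := law.pMin_bound hρ hx (hX.trans hXx) (htail x hXx)
  have hdiv : ∀ β, x ≤ β → β ≤ law.meanP * M * C / ρ ^ 2 →
      law.expNegRate M (1 - ρ * β / (M * C)) ≤ 1 / β → 0.27 * β ≤ law.optimalMeanWindow M C :=
    fun β h1 h2 h3 => law.diversity_bound hρ hM hC1 h2 (hX.trans (hXx.trans h1))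
      (htail β (hXx.trans h1)) h3
  simp only [h75, ← hx, mul_zero, sub_zero, add_zero]
  refine ⟨law.isGreatest_optimalMeanWindow M C, hmin, fun β h1 h2 h3 => ?_, fun B hB h3 => ?_,
    ?_, ?_⟩
  -- The `β` term of the minimum suffices, and its `⌊β⌋⁻¹` correction only lowers the claim.
  · refine max_le hmin (min_le_of_right_le (le_trans ?_ (hdiv β h1 h2 h3.ge)))
    have hβ : 0 < β := by linarith
    have : (0 : ℝ) ≤ (⌊β⌋ : ℝ)⁻¹ := inv_nonneg.2 (by exact_mod_cast Int.floor_nonneg.2 hβ.le)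
    rw [mul_comm]
    exact mul_le_mul_of_nonneg_right (by linarith) hβ.le
  · refine max_le hmin (le_trans ?_ (hdiv B (hB ▸ hpE) hB.le h3.le))
    have hB0 : 0 < B := by linarith
    rw [mul_comm]
    exact mul_le_mul_of_nonneg_right (by linarith) hB0.le
  · calc law.pMin / (2 * ρ ^ 2) * (law.meanP * M * C) = law.meanP * (x / 2) := by
          rw [hx]; field_simp
      _ ≤ x / 2 := mul_le_of_le_one_left (by linarith) law.meanP_le_one
      _ ≤ 0.75 * x - 1 := by linarith
      _ ≤ law.optimalMeanWindow M C := hmin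
  · calc law.optimalMeanWindow M C ≤ M * C + 1 :=
          law.le_of_mem_meanWindows (law.isGreatest_optimalMeanWindow M C).1
      _ ≤ 2 * (M * C) := by linarith
      _ = 2 / law.meanP * (law.meanP * M * C) := by field_simp
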